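/- For a finite simple graph $G$, let $\mu(G)$ denote its spectral radius, i.e. the largest eigenvalue of its adjacency matrix. For $n\ge k$ let $S_{n,k}=K_k\vee\overline{K_{n-k}}$ be the graph on $n$ vertices obtained by joining every vertex of a complete graph $K_k$ to every vertex of an independent set of $n-k$ vertices. For $k\ge 1$ let $T_2$ and $T_3$ be the following trees of order $2k+3$. The tree $T_2$ consists of a root joined to one vertex of each of $k$ disjoint copies of $K_2$ and to two further vertices, which are leaves. The tree $T_3$ consists of a root joined to the centre of a star $K_{1,2}$, to one vertex of each of $k-1$ disjoint copies of $K_2$, and to one further vertex, which is a leaf (the star and the copies of $K_2$ being pairwise disjoint). **Theorem.** Let $k\ge 3$ be an integer. There is an integer $N$, depending only on $k$, such that for every $n\ge N$, every graph $G$ of order $n$ with $\mu(G)\ge\mu(S_{n,k})$ that is not isomorphic to $S_{n,k}$ contains both $T_2$ and $T_3$ as (not necessarily induced) subgraphs. -/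

import Mathlib

/-- The spectral radius of a finite simple graph: the largest eigenvalue of its (real)
adjacency matrix. The spectrum of a real square matrix is its set of real eigenvalues; it is finite,
and it is nonempty for a symmetric matrix of positive order, so the supremum is a maximum
(see `isGreatest_graphSpectralRadius`). -/
noncomputable def graphSpectralRadius {V : Type*} [Fintype V] (G : SimpleGraph V) : ℝ :=
  open Classical in sSup (spectrum ℝ (G.adjMatrix ℝ))

open Classical in
theorem isGreatest_graphSpectralRadius {V : Type*} [Fintype V] [Nonempty V] (G : SimpleGraph V) :
    IsGreatest {x : ℝ | Module.End.HasEigenvalue (Matrix.toLin' (G.adjMatrix ℝ)) x}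
      (graphSpectralRadius G) := by
  have hs : {x : ℝ | Module.End.HasEigenvalue (Matrix.toLin' (G.adjMatrix ℝ)) x}
      = spectrum ℝ (G.adjMatrix ℝ) := by
    ext x
    rw [Set.mem_ofPred_eq, Module.End.hasEigenvalue_iff_mem_spectrum, Matrix.spectrum_toLin']
  have hA : (G.adjMatrix ℝ).IsHermitian := by
    rw [Matrix.IsHermitian, Matrix.conjTranspose_eq_transpose_of_trivial,
      SimpleGraph.transpose_adjMatrix]
  have hr := hA.spectrum_real_eq_range_eigenvalues
  have hf : (spectrum ℝ (G.adjMatrix ℝ)).Finite := hr ▸ Set.finite_range _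
  have hne : (spectrum ℝ (G.adjMatrix ℝ)).Nonempty := hr ▸ Set.range_nonempty _
  rw [hs]
  exact ⟨hne.csSup_mem hf, fun x hx => le_csSup hf.bddAbove hx⟩

/-- The graph `S_{n,k}`, the join of the complete graph `K_k` on the vertices `0, …, k - 1` with the
empty graph on the remaining `n - k` vertices (for `k ≤ n`): two distinct vertices are adjacent
if and only if at least one of them is among the first `k`. -/
def splitGraph (n k : ℕ) : SimpleGraph (Fin n) where
  Adj i j := i ≠ j ∧ (i.val < k ∨ j.val < k)
  symm := ⟨fun _ _ h => ⟨h.1.symm, h.2.symm⟩⟩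
  loopless := ⟨fun _ h => h.1 rfl⟩

/-- The vertices of the rooted tree `starTree m`: a root, and for each `i` the vertices of a star
`K_{1, m i}`. -/
inductive StarTreeVertex {p : ℕ} (m : Fin p → ℕ) : Type
  | root : StarTreeVertex m
  | center (i : Fin p) : StarTreeVertex m
  | leaf (i : Fin p) (j : Fin (m i)) : StarTreeVertex m

/-- The oriented edges (from parent to child) of the rooted tree `starTree m`. -/
inductive StarTreeVertex.IsParent {p : ℕ} (m : Fin p → ℕ) :
    StarTreeVertex m → StarTreeVertex m → Prop
  | root_center (i : Fin p) : IsParent m .root (.center i)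
  | center_leaf (i : Fin p) (j : Fin (m i)) : IsParent m (.center i) (.leaf i j)

/-- The tree of depth at most two in which a root is joined to the centres of `p` disjoint stars
`K_{1, m 0}, …, K_{1, m (p - 1)}`, where `K_{1,0}` is a single vertex. -/
def starTree {p : ℕ} (m : Fin p → ℕ) : SimpleGraph (StarTreeVertex m) :=
  SimpleGraph.fromRel (StarTreeVertex.IsParent m)

/-- The tree `T_2` of order `2k + 3`: deleting its root leaves `k` copies of `K_2 = K_{1,1}` and
two isolated vertices. -/
def treeT2 (k : ℕ) :=
  starTree (fun i : Fin (k + 2) => if i.val < k then 1 else 0)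

/-- The tree `T_3` of order `2k + 3` (for `k ≥ 1`): deleting its root leaves one copy of `K_{1,2}`,
`k - 1` copies of `K_2 = K_{1,1}`, and one isolated vertex. -/
def treeT3 (k : ℕ) :=
  starTree (fun i : Fin (k + 1) => if i.val = 0 then 2 else if i.val < k then 1 else 0)

/-! ### Matchings: greedy extension, vertex covers, enumeration. -/

section Matchings

variable {V : Type*}

open Classical

/-! The positive root of x² - (k-1)x = k(n-k) is an eigenvalue of S_{n,k}, so ρ = μ(G) satisfies ρ²
- (k-1)ρ ≥ k(n-k). Weighting the row sums of A² - (k-1)A by a nonnegative eigenvector of G produces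
a vertex u with Σ_{v∼u} d(v) - (k-1)d(u) ≥ k(n-k) (`exists_row_sum_ge_of_splitGraph_le`); everything
else is combinatorics around u.

Every edge of `nearGraph G u` has an end adjacent to u, so a matching of k such edges and two spare
neighbours of u form T_2 rooted at u. For T_3, one needs k-1 edges, a disjoint cherry centred at a
neighbour of u, and one spare neighbour. Vertices of degree at least 2k+10 in `nearGraph G u` can be
matched greedily, each counting as a matching edge.

If d(u) ≥ 2k+2 and one of the trees is missing, then `nearGraph G u` has bounded matching number,
hence a bounded vertex cover, and few large vertices. The inequality at u then forces k-1 large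
vertices, all adjacent to u, and turns into an equality: these and u are adjacent to every other
vertex (`exists_universal_of_matching_bound`). If d(u) ≤ 2k+1, then k neighbours of u are large.
Either d(u) = k and they are all universal, or the trees appear at u; the exception is T_2 with d(u)
= k+1, which is rooted at a neighbour of u (`treeT2_isContained_of_degree_eq`).

Once k universal vertices exist, either there is no edge outside them and G is S_{n,k}, or such an
edge completes both trees (`trees_isContained_of_universal`). -/

/-- `HasMatchingOn H s X` says that `H` has a matching with `s` edges whose set of endpoints
is `X`. -/
inductive HasMatchingOn (H : SimpleGraph V) : ℕ → Finset V → Prop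
  | empty : HasMatchingOn H 0 ∅
  | cons {s : ℕ} {X : Finset V} {a b : V} : HasMatchingOn H s X → H.Adj a b → a ∉ X → b ∉ X →
      HasMatchingOn H (s + 1) (insert a (insert b X))

namespace HasMatchingOn

variable {H : SimpleGraph V} {s : ℕ} {X : Finset V}

theorem card_eq (h : HasMatchingOn H s X) : X.card = 2 * s := by
  induction h with
  | empty => rfl
  | cons h hab ha hb ih =>
    rw [Finset.card_insert_of_notMem (by simp [ha, hab.ne]), Finset.card_insert_of_notMem hb, ih]
    ring

theorem exists_subset (h : HasMatchingOn H s X) {t : ℕ} (ht : t ≤ s) :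
    ∃ Y ⊆ X, HasMatchingOn H t Y := by
  induction h with
  | empty => exact ⟨∅, subset_rfl, by obtain rfl : t = 0 := by omega
                                      exact .empty⟩
  | @cons s X a b h hab ha hb ih =>
    rcases Nat.lt_or_ge s t with h1 | h1
    · obtain rfl : t = s + 1 := by omega
      exact ⟨_, subset_rfl, .cons h hab ha hb⟩
    · obtain ⟨Y, hY, hm⟩ := ih h1
      exact ⟨Y, hY.trans (by intro z; simp; tauto), hm⟩

/-- Each vertex of `F` spoils at most one edge of the matching. -/
theorem exists_disjoint (h : HasMatchingOn H s X) (F : Finset V) :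
    ∃ t, ∃ Y ⊆ X, HasMatchingOn H t Y ∧ Disjoint Y F ∧ s ≤ t + (F ∩ X).card := by
  induction h with
  | empty => exact ⟨0, ∅, subset_rfl, .empty, by simp, by simp⟩
  | @cons s X a b h hab ha hb ih =>
    obtain ⟨t, Y, hY, hm, hd, hc⟩ := ih
    by_cases haF : a ∈ F ∨ b ∈ F
    · refine ⟨t, Y, hY.trans (by intro z; simp; tauto), hm, hd, ?_⟩
      have : (F ∩ X).card < (F ∩ insert a (insert b X)).card := by
        apply Finset.card_lt_card
        rw [Finset.ssubset_iff_of_subset (by intro z; simp; tauto)]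
        rcases haF with h1 | h1
        · exact ⟨a, by simp [h1], by simp [ha]⟩
        · exact ⟨b, by simp [h1], by simp [hb]⟩
      omega
    · push Not at haF
      refine ⟨t + 1, insert a (insert b Y), ?_, .cons hm hab (fun h => ha (hY h))
        (fun h => hb (hY h)), ?_, ?_⟩
      · exact Finset.insert_subset_insert _ (Finset.insert_subset_insert _ hY)
      · simp [haF, hd]
      · have : (F ∩ X).card ≤ (F ∩ insert a (insert b X)).card :=
          Finset.card_le_card (by intro z; simp; tauto)
        omega

/-- Greedy choice: each vertex of `B` takes a partner outside `X`, `F` and the rest of `B`. Every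
step adds two to `X.card` and removes one vertex from `B`, so `X.card + 2 * B.card` is invariant and
the degree condition persists. `F` holds vertices reserved for other parts of a tree. -/
theorem exists_extension [Fintype V] (h : HasMatchingOn H s X) (F B : Finset V)
    (hB : Disjoint B X) (hdeg : ∀ v ∈ B, X.card + F.card + 2 * B.card ≤ H.degree v) :
    ∃ Y, HasMatchingOn H (s + B.card) Y ∧ ∀ z ∈ Y, z ∈ F → z ∈ X ∨ z ∈ B := by
  induction B using Finset.induction_on generalizing s X F with
  | empty => exact ⟨X, by simpa using h, fun z hz _ => Or.inl hz⟩
  | @insert v B hv ih =>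
    rw [Finset.card_insert_of_notMem hv] at hdeg ⊢
    have h1 := hdeg v (by simp)
    obtain ⟨w, hw, hw'⟩ : ∃ w ∈ H.neighborFinset v, w ∉ X ∪ F ∪ B := by
      apply Finset.exists_mem_notMem_of_card_lt_card
      rw [H.card_neighborFinset_eq_degree]
      have := Finset.card_union_le (X ∪ F) B
      have := Finset.card_union_le X F
      omega
    rw [SimpleGraph.mem_neighborFinset] at hw
    simp only [Finset.mem_union, not_or] at hw'
    have hvX : v ∉ X := fun hx => (Finset.disjoint_left.1 hB) (by simp) hx
    have hm := h.cons hw hvX hw'.1.1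
    obtain ⟨Y, hY, hY'⟩ := ih (F := F) hm (by
      rw [Finset.disjoint_insert_left] at hB
      simp only [Finset.disjoint_insert_right]
      exact ⟨hv, hw'.2, hB.2⟩) (by
      intro z hz
      have := hdeg z (by simp [hz])
      have h2 := hm.card_eq
      have h3 := h.card_eq
      omega)
    refine ⟨Y, by convert hY using 1; ring, fun z hz hzF => ?_⟩
    have := hY' z hz hzF
    simp only [Finset.mem_insert] at this ⊢
    rcases this with (rfl | rfl | h5) | h5
    · tauto
    · exact absurd hzF hw'.1.2
    · tauto
    · tauto

/-- The endpoints of a maximum matching cover all edges. -/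
theorem exists_vertexCover {m : ℕ} (hm : ∀ s X, HasMatchingOn H s X → s ≤ m) :
    ∃ X : Finset V, X.card ≤ 2 * m ∧ ∀ a b, H.Adj a b → a ∈ X ∨ b ∈ X := by
  have hex : ∃ s, ∃ X, HasMatchingOn H s X := ⟨0, ∅, .empty⟩
  obtain ⟨s, ⟨X, hX⟩, hs⟩ : ∃ s, (∃ X, HasMatchingOn H s X) ∧
      ∀ t, (∃ X, HasMatchingOn H t X) → t ≤ s := by
    refine ⟨Nat.findGreatest (fun s => ∃ X, HasMatchingOn H s X) m,
      Nat.findGreatest_spec (P := fun s => ∃ X, HasMatchingOn H s X) (Nat.zero_le m)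
        ⟨∅, .empty⟩, fun t ht => Nat.le_findGreatest ?_ ht⟩
    obtain ⟨X, hX⟩ := ht
    exact hm t X hX
  refine ⟨X, by rw [hX.card_eq]; have := hm s X hX; omega, fun a b hab => ?_⟩
  by_contra! hcon
  have := hs (s + 1) ⟨_, hX.cons hab hcon.1 hcon.2⟩
  omega

/-- Orients each edge so that its first end satisfies `P`. With `P` adjacency to the root, these
ends become centres and the others leaves; values at indices from `s` on are irrelevant. -/
theorem exists_enumeration (h : HasMatchingOn H s X) {P : V → Prop} [Nonempty V]
    (hP : ∀ a b, H.Adj a b → P a ∨ P b) :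
    ∃ c l : ℕ → V, (∀ i < s, H.Adj (c i) (l i) ∧ P (c i) ∧ c i ∈ X ∧ l i ∈ X) ∧
      (∀ i < s, ∀ j < s, c i = c j → i = j) ∧ (∀ i < s, ∀ j < s, l i = l j → i = j) ∧
      ∀ i < s, ∀ j < s, c i ≠ l j := by
  induction h with
  | empty =>
    obtain ⟨v⟩ := ‹Nonempty V›
    exact ⟨fun _ => v, fun _ => v, by simp, by simp, by simp, by simp⟩
  | @cons s X a b h hab ha hb ih =>
    obtain ⟨c, l, h1, h2, h3, h4⟩ := ih
    obtain ⟨a', b', hab', hPa, ha', hb', hins, hins'⟩ : ∃ a' b', H.Adj a' b' ∧ P a' ∧ a' ∉ X ∧ b' ∉ X ∧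
        a' ∈ insert a (insert b X) ∧ b' ∈ insert a (insert b X) := by
      rcases hP a b hab with h5 | h5
      · exact ⟨a, b, hab, h5, ha, hb, by simp, by simp⟩
      · exact ⟨b, a, hab.symm, h5, hb, ha, by simp, by simp⟩
    have hne := hab'.ne
    refine ⟨fun i => if i < s then c i else a', fun i => if i < s then l i else b', ?_, ?_, ?_, ?_⟩
    · intro i hi
      by_cases his : i < s
      · obtain ⟨p1, p2, p3, p4⟩ := h1 i his
        simp [his, p1, p2, p3, p4]
      · simp only [his, if_false]
        exact ⟨hab', hPa, hins, hins'⟩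
    all_goals
      intro i hi j hj
      by_cases his : i < s <;> by_cases hjs : j < s <;> simp only [his, hjs, if_true, if_false]
      all_goals grind

end HasMatchingOn

end Matchings

/-! ### From matchings around a root to the trees. -/

section Trees

variable {V : Type*} {G : SimpleGraph V}

theorem starTree_isContained {p : ℕ} {m : Fin p → ℕ} (r : V) (c : Fin p → V)
    (l : ∀ i, Fin (m i) → V) (hc : ∀ i, G.Adj r (c i)) (hl : ∀ i j, G.Adj (c i) (l i j))
    (hcinj : Function.Injective c) (hlr : ∀ i j, l i j ≠ r) (hcl : ∀ i i' j, c i ≠ l i' j)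
    (hlinj : ∀ i j i' j', l i j = l i' j' → i = i' ∧ (j : ℕ) = j') :
    (starTree m).IsContained G := by
  let f : StarTreeVertex m → V := fun v =>
    match v with
    | .root => r
    | .center i => c i
    | .leaf i j => l i j
  have hpar : ∀ a b, StarTreeVertex.IsParent m a b → G.Adj (f a) (f b) := by
    rintro _ _ (i | ⟨i, j⟩)
    · exact hc i
    · exact hl i j
  refine ⟨⟨⟨f, ?_⟩, ?_⟩⟩
  · rintro a b hab
    rcases hab.2 with h | h
    · exact hpar a b h
    · exact (hpar b a h).symm
  · rintro (_ | i | ⟨i, j⟩) (_ | i' | ⟨i', j'⟩) h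
    · rfl
    · exact absurd h (hc i').ne
    · exact absurd h.symm (hlr i' j')
    · exact absurd h (hc i).ne'
    · exact congrArg _ (hcinj h)
    · exact absurd h (hcl i i' j')
    · exact absurd h (hlr i j)
    · exact absurd h.symm (hcl i' i j)
    · obtain ⟨rfl, h2⟩ := hlinj _ _ _ _ h
      rw [Fin.ext h2]

/-- The graph of the edges of `G - u` which meet the neighbourhood of `u`. -/
def nearGraph (G : SimpleGraph V) (u : V) : SimpleGraph V where
  Adj a b := G.Adj a b ∧ a ≠ u ∧ b ≠ u ∧ (G.Adj u a ∨ G.Adj u b)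
  symm := ⟨fun _ _ h => ⟨h.1.symm, h.2.2.1, h.2.1, h.2.2.2.symm⟩⟩
  loopless := ⟨fun _ h => h.1.ne rfl⟩

theorem treeT2_isContained_of_matching {k : ℕ} {u x y : V} {X : Finset V}
    (hX : HasMatchingOn (nearGraph G u) k X) (hx : G.Adj u x) (hy : G.Adj u y) (hxy : x ≠ y)
    (hxX : x ∉ X) (hyX : y ∉ X) : (treeT2 k).IsContained G := by
  have : Nonempty V := ⟨u⟩
  obtain ⟨c, l, h1, h2, h3, h4⟩ := hX.exists_enumeration (P := fun v => G.Adj u v)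
    (fun a b h => h.2.2.2)
  -- A leaf index exists only below the first `k` centres.
  have hlt : ∀ (i : Fin (k + 2)), Fin (if i.val < k then 1 else 0) → i.val < k := by
    intro i j
    by_contra h
    rw [if_neg h] at j
    exact j.elim0
  refine starTree_isContained u
    (fun i => if i.val < k then c i else if i.val = k then x else y) (fun i _ => l i) ?_ ?_ ?_ ?_ ?_ ?_
  · intro i
    have := h1 i
    grind
  · intro i j
    have hi := hlt i j
    simp only [hi, if_true]
    exact (h1 i hi).1.1
  · intro i j hij
    have hi2 := i.isLt
    have hj2 := j.isLt
    have := h1 i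
    have := h1 j
    have := h2 i
    apply Fin.ext
    grind
  · intro i j
    exact (h1 i (hlt i j)).1.2.2.1
  · intro i i' j
    have hi := hlt i' j
    have := h1 i' hi
    have := h4 i
    grind
  · intro i j i' j' h
    have hi := hlt i j
    have hi' := hlt i' j'
    refine ⟨Fin.ext (h3 i hi i' hi' h), ?_⟩
    have := j.isLt
    have := j'.isLt
    simp only [hi, hi', if_true] at *
    omega

theorem treeT3_isContained_of_matching {k : ℕ} (hk : 1 ≤ k) {u x c₀ a b : V} {X : Finset V}
    (hX : HasMatchingOn (nearGraph G u) (k - 1) X) (hx : G.Adj u x) (hc₀ : G.Adj u c₀)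
    (ha : (nearGraph G u).Adj c₀ a) (hb : (nearGraph G u).Adj c₀ b) (hab : a ≠ b)
    (hxc : x ≠ c₀) (hxa : x ≠ a) (hxb : x ≠ b)
    (hxX : x ∉ X) (hcX : c₀ ∉ X) (haX : a ∉ X) (hbX : b ∉ X) : (treeT3 k).IsContained G := by
  have : Nonempty V := ⟨u⟩
  obtain ⟨c, l, h1, h2, h3, h4⟩ := hX.exists_enumeration (P := fun v => G.Adj u v)
    (fun a b h => h.2.2.2)
  have hac := ha.ne
  have hbc := hb.ne
  have hlt : ∀ (i : Fin (k + 1)), ∀ j : Fin (if i.val = 0 then 2 else if i.val < k then 1 else 0),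
      (i.val = 0 ∧ j.val < 2) ∨ (i.val ≠ 0 ∧ i.val - 1 < k - 1 ∧ j.val = 0) := by
    rintro i ⟨j, hj⟩
    by_cases h0 : i.val = 0
    · rw [if_pos h0] at hj
      exact Or.inl ⟨h0, hj⟩
    · rw [if_neg h0] at hj
      by_cases h1 : i.val < k
      · rw [if_pos h1] at hj
        exact Or.inr ⟨h0, by omega, by simpa using hj⟩
      · rw [if_neg h1] at hj
        exact absurd hj (Nat.not_lt_zero _)
  -- Centre 0 carries the cherry, centres 1 to k-1 use the matching with index shifted by one, and
  -- centre k is the childless neighbour `x`.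
  refine starTree_isContained u
    (fun i => if i.val = 0 then c₀ else if i.val < k then c (i.val - 1) else x)
    (fun i j => if i.val = 0 then (if j.val = 0 then a else b) else l (i.val - 1)) ?_ ?_ ?_ ?_ ?_ ?_
  · intro i
    have := h1 (i - 1)
    grind
  · intro i j
    rcases hlt i j with ⟨hi, hj⟩ | ⟨hi, hi', hj⟩
    · simp only [hi, if_true]
      by_cases hj0 : j.val = 0
      · rw [if_pos hj0]
        exact ha.1
      · rw [if_neg hj0]
        exact hb.1
    · simp only [hi, if_false, show i.val < k by omega, if_true]
      exact (h1 _ hi').1.1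
  · intro i j hij
    have hi2 := i.isLt
    have hj2 := j.isLt
    have := h1 (i - 1)
    have := h1 (j - 1)
    have := h2 (i - 1)
    apply Fin.ext
    grind
  · intro i j
    rcases hlt i j with ⟨hi, hj⟩ | ⟨hi, hi', hj⟩
    · simp only [hi, if_true]
      by_cases hj0 : j.val = 0
      · rw [if_pos hj0]
        exact ha.2.2.1
      · rw [if_neg hj0]
        exact hb.2.2.1
    · simp only [hi, if_false]
      exact (h1 _ hi').1.2.2.1
  · intro i i' j
    have := h1 (i' - 1)
    have := h1 (i - 1)
    have := h4 (i - 1)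
    have := hlt i' j
    grind
  · intro i j i' j' h
    have := h1 (i' - 1)
    have := h1 (i - 1)
    have := h3 (i - 1)
    have := hlt i' j'
    have := hlt i j
    rw [Fin.ext_iff]
    grind

end Trees

/-! ### Trees from vertices of large degree; recognising S_{n,k}. -/

section Embeddings

open Classical

variable {V : Type*} [Fintype V] {G : SimpleGraph V}

theorem treeT2_isContained_of_large_degrees {k s : ℕ} {u x y : V} {X B : Finset V}
    (hX : HasMatchingOn (nearGraph G u) s X) (hBX : Disjoint B X)
    (hB : ∀ v ∈ B, 2 * k + 10 ≤ (nearGraph G u).degree v) (hcard : s + B.card = k)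
    (hx : G.Adj u x) (hy : G.Adj u y) (hxy : x ≠ y) (hxX : x ∉ X) (hyX : y ∉ X) (hxB : x ∉ B)
    (hyB : y ∉ B) : (treeT2 k).IsContained G := by
  obtain ⟨Y, hY, hYF⟩ := hX.exists_extension {x, y} B hBX (by
    intro v hv
    have := hB v hv
    have := hX.card_eq
    have := Finset.card_le_two (a := x) (b := y)
    omega)
  rw [hcard] at hY
  refine treeT2_isContained_of_matching hY hx hy hxy (fun h => ?_) (fun h => ?_)
  · have := hYF x h (by simp)
    tauto
  · have := hYF y h (by simp)
    tauto

/-- The large vertex `c` is kept out of the matching to be the centre of the cherry: once the other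
k-1 edges are chosen, its degree still leaves two free leaves. -/
theorem treeT3_isContained_of_large_degrees {k s : ℕ} {u x c : V} {X B : Finset V}
    (hX : HasMatchingOn (nearGraph G u) s X) (hBX : Disjoint B X)
    (hB : ∀ v ∈ B, 2 * k + 10 ≤ (nearGraph G u).degree v) (hcard : s + B.card = k)
    (hc : c ∈ B) (huc : G.Adj u c) (hx : G.Adj u x) (hxX : x ∉ X) (hxB : x ∉ B) :
    (treeT3 k).IsContained G := by
  have hcard' := Finset.card_erase_add_one hc
  have hcX : c ∉ X := Finset.disjoint_left.1 hBX hc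
  obtain ⟨Y, hY, hYF⟩ := hX.exists_extension {x, c} (B.erase c)
    (hBX.mono_left (Finset.erase_subset _ _)) (by
    intro v hv
    have := hB v (Finset.mem_of_mem_erase hv)
    have := hX.card_eq
    have := Finset.card_le_two (a := x) (b := c)
    omega)
  rw [show s + (B.erase c).card = k - 1 by omega] at hY
  have hxY : x ∉ Y := fun h => by
    have := hYF x h (by simp)
    simp only [Finset.mem_erase] at this
    tauto
  have hcY : c ∉ Y := fun h => by
    have := hYF c h (by simp)
    simp only [Finset.mem_erase] at this
    tauto
  have hY2 := hY.card_eq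
  have hdc := hB c hc
  have hex : ∀ z, ∃ a ∈ (nearGraph G u).neighborFinset c, a ∉ insert z (insert x Y) := by
    intro z
    apply Finset.exists_mem_notMem_of_card_lt_card
    rw [SimpleGraph.card_neighborFinset_eq_degree]
    have := Finset.card_insert_le z (insert x Y)
    have := Finset.card_insert_le x Y
    omega
  obtain ⟨a, ha, ha'⟩ := hex x
  obtain ⟨b, hb, hb'⟩ := hex a
  simp only [SimpleGraph.mem_neighborFinset, Finset.mem_insert, not_or] at ha ha' hb hb'
  exact treeT3_isContained_of_matching (by omega) hY hx huc ha hb (Ne.symm hb'.1)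
    (by rintro rfl; exact hxB hc) (Ne.symm ha'.1) (Ne.symm hb'.2.1) hxY hcY ha'.2.2 hb'.2.2

theorem treeT3_isContained_of_cherry {k s : ℕ} (hk : 1 ≤ k) {u c a b : V} {X B : Finset V}
    (hX : HasMatchingOn (nearGraph G u) s X) (hBX : Disjoint B X)
    (hB : ∀ v ∈ B, 2 * k + 10 ≤ (nearGraph G u).degree v) (hcard : s + B.card = k - 1)
    (huc : G.Adj u c) (ha : (nearGraph G u).Adj c a) (hb : (nearGraph G u).Adj c b) (hab : a ≠ b)
    (hX' : Disjoint X {c, a, b}) (hB' : Disjoint B {c, a, b}) (hu : 2 * k + 2 ≤ G.degree u) :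
    (treeT3 k).IsContained G := by
  have h3 : ({c, a, b} : Finset V).card ≤ 3 := Finset.card_le_three
  obtain ⟨Y, hY, hYF⟩ := hX.exists_extension {c, a, b} B hBX (by
    intro v hv
    have := hB v hv
    have := hX.card_eq
    omega)
  rw [hcard] at hY
  have hdis : ∀ z ∈ ({c, a, b} : Finset V), z ∉ Y := fun z hz h => by
    rcases hYF z h hz with h1 | h1
    · exact Finset.disjoint_left.1 hX' h1 hz
    · exact Finset.disjoint_left.1 hB' h1 hz
  -- At most 2(k-1) + 3 = 2k+1 vertices are excluded.
  obtain ⟨x, hx, hx'⟩ : ∃ x ∈ G.neighborFinset u, x ∉ Y ∪ {c, a, b} := by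
    apply Finset.exists_mem_notMem_of_card_lt_card
    rw [SimpleGraph.card_neighborFinset_eq_degree]
    have := Finset.card_union_le Y {c, a, b}
    have := hY.card_eq
    omega
  simp only [SimpleGraph.mem_neighborFinset, Finset.mem_union, Finset.mem_insert,
    Finset.mem_singleton, not_or] at hx hx'
  exact treeT3_isContained_of_matching hk hY hx huc ha hb hab hx'.2.1 hx'.2.2.1 hx'.2.2.2 hx'.1
    (hdis c (by simp)) (hdis a (by simp)) (hdis b (by simp))

theorem le_degree_nearGraph_of_universal {u v : V} (huv : u ≠ v) (hu : ∀ w, w ≠ u → G.Adj u w)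
    (hv : ∀ w, w ≠ v → G.Adj v w) : Fintype.card V ≤ (nearGraph G u).degree v + 2 := by
  rw [← SimpleGraph.card_neighborFinset_eq_degree, ← Finset.card_univ]
  have : (Finset.univ : Finset V) ⊆ (nearGraph G u).neighborFinset v ∪ {u, v} := by
    intro w _
    simp only [Finset.mem_union, SimpleGraph.mem_neighborFinset, Finset.mem_insert,
      Finset.mem_singleton]
    by_cases h1 : w = u
    · tauto
    by_cases h2 : w = v
    · tauto
    exact Or.inl ⟨hv w h2, huv.symm, h1, Or.inr (hu w h1)⟩
  refine (Finset.card_le_card this).trans ((Finset.card_union_le _ _).trans ?_)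
  have := Finset.card_le_two (a := u) (b := v)
  omega

/-- Root the trees at one vertex of `K`: the edge `xy` is one matching edge and the other k-1
vertices of `K` are large, which makes k in total. -/
theorem trees_isContained_of_universal {k : ℕ} (hk : 2 ≤ k) (hV : 3 * k + 20 ≤ Fintype.card V)
    {K : Finset V} (hK : K.card = k) (huniv : ∀ v ∈ K, ∀ w, w ≠ v → G.Adj v w) {x y : V}
    (hxy : G.Adj x y) (hx : x ∉ K) (hy : y ∉ K) :
    (treeT2 k).IsContained G ∧ (treeT3 k).IsContained G := by
  obtain ⟨r, hr, c, hc, hrc⟩ := Finset.one_lt_card.1 (show 1 < K.card by omega)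
  have hxr : x ≠ r := by rintro rfl; exact hx hr
  have hyr : y ≠ r := by rintro rfl; exact hy hr
  have hm : HasMatchingOn (nearGraph G r) (0 + 1) (insert x (insert y ∅)) :=
    .cons .empty ⟨hxy, hxr, hyr, Or.inl (huniv r hr x hxr)⟩ (by simp) (by simp)
  have hdis : Disjoint (K.erase r) (insert x (insert y ∅)) := by
    rw [Finset.disjoint_left]
    intro a ha
    simp only [Finset.mem_erase] at ha
    simp only [Finset.mem_insert, Finset.notMem_empty, or_false]
    rintro (rfl | rfl)
    · exact hx ha.2
    · exact hy ha.2
  have hbig : ∀ v ∈ K.erase r, 2 * k + 10 ≤ (nearGraph G r).degree v := by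
    intro v hv
    rw [Finset.mem_erase] at hv
    have := le_degree_nearGraph_of_universal (Ne.symm hv.1) (huniv r hr) (huniv v hv.2)
    omega
  have hcard := Finset.card_erase_add_one hr
  have hex : ∀ w, ∃ z ∈ (Finset.univ : Finset V), z ∉ insert w (insert x (insert y K)) := by
    intro w
    apply Finset.exists_mem_notMem_of_card_lt_card
    have := Finset.card_insert_le w (insert x (insert y K))
    have := Finset.card_insert_le x (insert y K)
    have := Finset.card_insert_le y K
    rw [Finset.card_univ]
    omega
  obtain ⟨p, -, hp⟩ := hex x
  obtain ⟨q, -, hq⟩ := hex p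
  simp only [Finset.mem_insert, not_or] at hp hq
  have hpr : p ≠ r := by rintro rfl; exact hp.2.2.2 hr
  have hqr : q ≠ r := by rintro rfl; exact hq.2.2.2 hr
  constructor
  · exact treeT2_isContained_of_large_degrees hm hdis hbig (by omega) (huniv r hr p hpr)
      (huniv r hr q hqr) (Ne.symm hq.1) (by simp [hp]) (by simp [hq]) (by simp [hp]) (by simp [hq])
  · exact treeT3_isContained_of_large_degrees hm hdis hbig (by omega) (c := c)
      (by simp [hc, hrc.symm]) (huniv r hr c hrc.symm) (huniv r hr p hpr) (by simp [hp])
      (by simp [hp])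

theorem nonempty_iso_splitGraph {n k : ℕ} {G : SimpleGraph (Fin n)} (hkn : k ≤ n)
    {K : Finset (Fin n)} (hK : K.card = k) (huniv : ∀ v ∈ K, ∀ w, w ≠ v → G.Adj v w)
    (hind : ∀ x y, G.Adj x y → x ∈ K ∨ y ∈ K) : Nonempty (G ≃g splitGraph n k) := by
  have hc : Fintype.card {v : Fin n // v ∈ K} = Fintype.card {i : Fin n // i.val < k} := by
    have h := Fin.card_filter_val_lt (n := n) (m := k)
    rw [min_eq_right hkn] at h
    rw [Fintype.card_coe, hK, Fintype.card_subtype]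
    convert h.symm
  let e := (Fintype.equivOfCardEq hc).extendSubtype
  have he : ∀ v, (e v).val < k ↔ v ∈ K := fun v =>
    ⟨fun h => by
      by_contra h1
      exact (Fintype.equivOfCardEq hc).extendSubtype_not_mem v h1 h,
      fun h => (Fintype.equivOfCardEq hc).extendSubtype_mem v h⟩
  refine ⟨⟨e, fun {a b} => ?_⟩⟩
  change (e a ≠ e b ∧ ((e a).val < k ∨ (e b).val < k)) ↔ _
  rw [he, he, e.injective.ne_iff]
  constructor
  · rintro ⟨h1, h2 | h2⟩
    · exact huniv a h2 b h1.symm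
    · exact (huniv b h2 a h1).symm
  · exact fun h => ⟨h.ne, hind a b h⟩

end Embeddings

/-! ### Edge counting around `u` when its degree is large. -/

section Counting

open Classical Finset

variable {V : Type*} [Fintype V] {G : SimpleGraph V}

theorem adj_of_degree_add_one_eq {v : V} (h : G.degree v + 1 = Fintype.card V) (w : V)
    (hw : w ≠ v) : G.Adj v w := by
  have h1 : G.neighborFinset v = univ.erase v := by
    apply eq_of_subset_of_card_le
    · intro z hz
      rw [SimpleGraph.mem_neighborFinset] at hz
      simp [hz.ne']
    · rw [card_erase_of_mem (mem_univ v), G.card_neighborFinset_eq_degree, card_univ]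
      omega
  rw [← SimpleGraph.mem_neighborFinset, h1]
  simp [hw]

theorem degree_nearGraph_add_one {u v : V} (h : G.Adj u v) :
    (nearGraph G u).degree v + 1 = G.degree v := by
  have h1 : (nearGraph G u).neighborFinset v = (G.neighborFinset v).erase u := by
    ext w
    rw [SimpleGraph.mem_neighborFinset, mem_erase, SimpleGraph.mem_neighborFinset]
    exact ⟨fun h => ⟨h.2.2.1, h.1⟩, fun h' => ⟨h'.2, h.ne', h'.1, Or.inl h⟩⟩
  rw [← SimpleGraph.card_neighborFinset_eq_degree, h1, card_erase_add_one (by simpa using h.symm),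
    SimpleGraph.card_neighborFinset_eq_degree]

theorem sum_degree_nearGraph (u : V) :
    ∑ v ∈ G.neighborFinset u, (nearGraph G u).degree v + G.degree u
      = ∑ v ∈ G.neighborFinset u, G.degree v := by
  rw [← G.card_neighborFinset_eq_degree u, card_eq_sum_ones, ← sum_add_distrib]
  exact sum_congr rfl fun v hv =>
    degree_nearGraph_add_one ((SimpleGraph.mem_neighborFinset _ _ _).1 hv)

/-- The sum is twice the number of edges avoiding `B`; each of these has an end in `X \ B`, where
degrees are at most `D`. -/
theorem sum_card_neighborFinset_sdiff_le {H : SimpleGraph V} {X B : Finset V} {D : ℕ}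
    (hX : ∀ a b, H.Adj a b → a ∈ X ∨ b ∈ X) (hD : ∀ v, v ∉ B → H.degree v ≤ D) :
    ∑ v ∈ Bᶜ, (H.neighborFinset v \ B).card ≤ 2 * X.card * D := by
  have hXB : (X \ B).card ≤ X.card := card_le_card sdiff_subset
  have hsum : ∑ x ∈ X \ B, H.degree x ≤ X.card * D := by
    refine (sum_le_card_nsmul _ _ D fun v hv => hD v (mem_sdiff.1 hv).2).trans ?_
    rw [smul_eq_mul]
    gcongr
  rw [← sum_inter_add_sum_sdiff Bᶜ X]
  have h1 : ∑ v ∈ Bᶜ ∩ X, (H.neighborFinset v \ B).card ≤ ∑ x ∈ X \ B, H.degree x := by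
    have : Bᶜ ∩ X = X \ B := by ext; simp [and_comm]
    rw [this]
    refine sum_le_sum fun v _ => ?_
    rw [← H.card_neighborFinset_eq_degree]
    exact card_le_card sdiff_subset
  have h2 : ∑ v ∈ Bᶜ \ X, (H.neighborFinset v \ B).card ≤ ∑ x ∈ X \ B, H.degree x := by
    calc ∑ v ∈ Bᶜ \ X, (H.neighborFinset v \ B).card
        ≤ ∑ v ∈ Bᶜ \ X, (bipartiteAbove H.Adj (X \ B) v).card := by
          refine sum_le_sum fun v hv => card_le_card fun w hw => ?_
          simp only [mem_sdiff, SimpleGraph.mem_neighborFinset, mem_bipartiteAbove] at hw hv ⊢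
          have := hX v w hw.1
          tauto
      _ = ∑ x ∈ X \ B, (bipartiteBelow H.Adj (Bᶜ \ X) x).card :=
          sum_card_bipartiteAbove_eq_sum_card_bipartiteBelow _
      _ ≤ ∑ x ∈ X \ B, H.degree x := by
          refine sum_le_sum fun x _ => ?_
          rw [← H.card_neighborFinset_eq_degree]
          refine card_le_card fun w hw => ?_
          simp only [mem_bipartiteBelow, SimpleGraph.mem_neighborFinset] at hw ⊢
          exact hw.2.symm
  calc _ ≤ X.card * D + X.card * D := add_le_add (h1.trans hsum) (h2.trans hsum)
    _ = _ := by ring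

/-- A vertex outside `B` sends at most `B.card` edges into `B`. -/
theorem sum_degree_le_of_split {H : SimpleGraph V} (S B : Finset V) :
    ∑ v ∈ S, H.degree v ≤ ∑ v ∈ S ∩ B, H.degree v + (S \ B).card * B.card
      + ∑ v ∈ Bᶜ, (H.neighborFinset v \ B).card := by
  rw [← sum_inter_add_sum_sdiff S B, add_assoc]
  gcongr
  calc ∑ v ∈ S \ B, H.degree v
      ≤ ∑ v ∈ S \ B, (B.card + (H.neighborFinset v \ B).card) := by
        refine sum_le_sum fun v _ => ?_
        rw [← H.card_neighborFinset_eq_degree, ← card_inter_add_card_sdiff _ B]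
        gcongr
        exact inter_subset_right
    _ = (S \ B).card * B.card + ∑ v ∈ S \ B, (H.neighborFinset v \ B).card := by
        rw [sum_add_distrib, sum_const, smul_eq_mul]
    _ ≤ _ := by
        gcongr
        intro v hv
        simp only [mem_sdiff, mem_compl] at hv ⊢
        exact hv.2

/-- If the large-degree vertices of `nearGraph G u` are few and `u` has many walks of length two,
then `u` lies in a set of `k` vertices adjacent to all others. -/
theorem exists_universal_of_matching_bound {k : ℕ} (hk : 3 ≤ k)
    (hV : 100 * (k + 10) ^ 2 ≤ Fintype.card V) {u : V}
    (hu : k * Fintype.card V + k * G.degree u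
      ≤ ∑ v ∈ G.neighborFinset u, G.degree v + k * k + G.degree u)
    (hm : ∀ s X, HasMatchingOn (nearGraph G u) s X → s ≤ k + 1) {B : Finset V}
    (hB : ∀ v, v ∈ B ↔ 2 * k + 10 ≤ (nearGraph G u).degree v) (hBk : B.card ≤ k)
    (hBk' : ∀ c ∈ B, G.Adj u c → B.card + 1 ≤ k)
    (hcov : ∀ c ∈ B, G.Adj u c → B.card + 1 = k →
      ∀ a b, (nearGraph G u).Adj a b → a ∈ B ∨ b ∈ B) :
    ∃ K : Finset V, K.card = k ∧ ∀ v ∈ K, ∀ w, w ≠ v → G.Adj v w := by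
  obtain ⟨X, hXc, hX⟩ := HasMatchingOn.exists_vertexCover hm
  have hrest := sum_card_neighborFinset_sdiff_le (B := B) (D := 2 * k + 10) hX (fun v hv => by
    rw [hB] at hv
    omega)
  have hsplit := sum_degree_le_of_split (H := nearGraph G u) (G.neighborFinset u) B
  have hdeg := sum_degree_nearGraph (G := G) u
  rw [← hdeg] at hu
  clear hdeg
  have hd := G.degree_lt_card_verts u
  have hlt : ∀ v ∈ G.neighborFinset u ∩ B, (nearGraph G u).degree v + 2 ≤ Fintype.card V := by
    intro v hv
    rw [mem_inter, SimpleGraph.mem_neighborFinset] at hv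
    have := degree_nearGraph_add_one hv.1
    have := G.degree_lt_card_verts v
    omega
  have hNB : (G.neighborFinset u \ B).card + (G.neighborFinset u ∩ B).card = G.degree u := by
    rw [card_sdiff_add_card_inter, G.card_neighborFinset_eq_degree]
  have hbB : (G.neighborFinset u ∩ B).card ≤ B.card := card_le_card inter_subset_right
  have hsumB : ∑ v ∈ G.neighborFinset u ∩ B, (nearGraph G u).degree v
      ≤ (G.neighborFinset u ∩ B).card * Fintype.card V :=
    sum_le_card_nsmul _ _ _ fun v hv => by have := hlt v hv; omega
  have hprod : (G.neighborFinset u \ B).card * B.card ≤ G.degree u * B.card :=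
    Nat.mul_le_mul_right _ (by omega)
  have hrest' : 2 * X.card * (2 * k + 10) ≤ 8 * k * k + 48 * k + 40 := by
    calc 2 * X.card * (2 * k + 10) ≤ 2 * (2 * (k + 1)) * (2 * k + 10) := by gcongr
      _ = _ := by ring
  set n := Fintype.card V
  set d := G.degree u
  set b := (G.neighborFinset u ∩ B).card with hb
  have hn : 9 * k * k + 48 * k + 41 ≤ n := by nlinarith
  -- With no large neighbour of `u` the inequality gives kn ≤ 2d + O(k²), impossible for k ≥ 3 since
  -- d < n.
  rcases Nat.eq_zero_or_pos b with hb0 | hbpos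
  · exfalso
    rw [hb0] at hsumB
    have h1 : d * B.card ≤ d * k := Nat.mul_le_mul_left _ hBk
    have h2 : 3 * n ≤ k * n := Nat.mul_le_mul_right _ hk
    nlinarith
  obtain ⟨c, hc⟩ := card_pos.1 hbpos
  rw [mem_inter, SimpleGraph.mem_neighborFinset] at hc
  have hBk1 := hBk' c hc.2 hc.1
  -- Now `B.card` is at most k-1, so kn ≤ bn + d + O(k²), which excludes b ≤ k-2.
  rcases Nat.lt_or_ge (b + 1) k with hbk | hbk
  · exfalso
    have h1 : d * (B.card + 1) ≤ d * k := Nat.mul_le_mul_left _ hBk1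
    have h2 : (b + 2) * n ≤ k * n := Nat.mul_le_mul_right _ hbk
    nlinarith
  have hBc : B.card + 1 = k := by omega
  have hcov' := hcov c hc.2 hc.1 hBc
  have hBN : G.neighborFinset u ∩ B = B := eq_of_subset_of_card_le inter_subset_right (by omega)
  -- Since `B` covers all edges, the O(k²) error vanishes; the inequality becomes exact and forces d
  -- = n-1 and maximal degree at every vertex of `B`.
  have hzero : ∑ v ∈ Bᶜ, ((nearGraph G u).neighborFinset v \ B).card = 0 := by
    refine sum_eq_zero fun v hv => ?_
    rw [card_eq_zero, sdiff_eq_empty_iff_subset]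
    intro w hw
    rw [SimpleGraph.mem_neighborFinset] at hw
    exact (hcov' v w hw).resolve_left (mem_compl.1 hv)
  have hBadj : ∀ v ∈ B, G.Adj u v := fun v hv => by
    rw [← hBN, mem_inter, SimpleGraph.mem_neighborFinset] at hv
    exact hv.1
  have huB : u ∉ B := fun h => (hBadj u h).ne rfl
  rw [hBN] at hlt hsplit
  have hbB' : b = B.card := by rw [hb, hBN]
  have hs2 : ∑ v ∈ B, ((nearGraph G u).degree v + 2) ≤ B.card * n :=
    sum_le_card_nsmul _ _ _ hlt
  have hs3 : ∑ v ∈ B, ((nearGraph G u).degree v + 2)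
      = ∑ v ∈ B, (nearGraph G u).degree v + B.card * 2 := by
    rw [sum_add_distrib, sum_const, smul_eq_mul]
  obtain ⟨q, hq⟩ : ∃ q, q = B.card := ⟨_, rfl⟩
  rw [← hq] at hs2 hs3 hBc hsplit hbB'
  obtain rfl : k = q + 1 := hBc.symm
  rw [hbB'] at hNB
  obtain ⟨e, he⟩ : ∃ e, e = (G.neighborFinset u \ B).card := ⟨_, rfl⟩
  rw [← he] at hsplit hNB
  rw [hzero] at hsplit
  have hqd : q * d = q * e + q * q := by rw [← hNB]; ring
  have hdn : d + 1 = n := by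
    refine le_antisymm hd ?_
    linarith
  have hsum : ∑ v ∈ B, ((nearGraph G u).degree v + 2) = ∑ v ∈ B, n := by
    rw [sum_const, smul_eq_mul, ← hq]
    refine le_antisymm hs2 ?_
    rw [← hdn] at hu ⊢
    linarith
  have heq := (sum_eq_sum_iff_of_le hlt).1 hsum
  refine ⟨insert u B, by rw [card_insert_of_notMem huB, hq], fun v hv w hw => ?_⟩
  rw [mem_insert] at hv
  rcases hv with rfl | hv
  · exact adj_of_degree_add_one_eq hdn w hw
  · have h1 := heq v hv
    have h2 := degree_nearGraph_add_one (hBadj v hv)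
    exact adj_of_degree_add_one_eq (by omega) w hw

theorem exists_universal_or_treeT2_of_large_degree {k : ℕ} (hk : 3 ≤ k)
    (hV : 100 * (k + 10) ^ 2 ≤ Fintype.card V) {u : V}
    (hu : k * Fintype.card V + k * G.degree u
      ≤ ∑ v ∈ G.neighborFinset u, G.degree v + k * k + G.degree u)
    (hd : 2 * k + 2 ≤ G.degree u) :
    (∃ K : Finset V, K.card = k ∧ ∀ v ∈ K, ∀ w, w ≠ v → G.Adj v w) ∨ (treeT2 k).IsContained G := by
  by_contra hcon
  obtain ⟨hK, hT⟩ := not_or.1 hcon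
  -- A matching and disjoint large vertices totalling k would occupy at most 2k neighbours of `u`,
  -- leaving two spare ones for T_2.
  have key : ∀ s X C, HasMatchingOn (nearGraph G u) s X → Disjoint C X →
      (∀ v ∈ C, 2 * k + 10 ≤ (nearGraph G u).degree v) → s + C.card ≠ k := by
    intro s X C hX hCX hC hcard
    obtain ⟨x, y, hx, hy, hxy⟩ : ∃ x y, x ∈ G.neighborFinset u \ (X ∪ C) ∧
        y ∈ G.neighborFinset u \ (X ∪ C) ∧ x ≠ y := by
      apply one_lt_card_iff.1
      have := le_card_sdiff (X ∪ C) (G.neighborFinset u)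
      rw [G.card_neighborFinset_eq_degree] at this
      have := card_union_le X C
      have := hX.card_eq
      omega
    simp only [mem_sdiff, SimpleGraph.mem_neighborFinset, mem_union, not_or] at hx hy
    exact hT (treeT2_isContained_of_large_degrees hX hCX hC hcard hx.1 hy.1 hxy hx.2.1 hy.2.1
      hx.2.2 hy.2.2)
  have hBk : ((univ.filter fun v => 2 * k + 10 ≤ (nearGraph G u).degree v).card) + 1 ≤ k := by
    by_contra! hlt
    obtain ⟨C, hC, hCk⟩ := exists_subset_card_eq (Nat.le_of_lt_succ hlt)
    exact key 0 ∅ C .empty (by simp) (fun v hv => by simpa using hC hv) (by omega)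
  apply hK
  refine exists_universal_of_matching_bound hk hV hu ?_ (fun v => by simp) (Nat.le_of_succ_le hBk)
    (fun _ _ _ => hBk) ?_
  · intro s X hX
    by_contra! hs
    obtain ⟨Y, -, hY⟩ := hX.exists_subset (show k ≤ s by omega)
    exact key k Y ∅ hY (by simp) (by simp) (by simp)
  · intro c _ _ hcard a b hab
    by_contra! hab'
    refine key (0 + 1) _ (univ.filter fun v => 2 * k + 10 ≤ (nearGraph G u).degree v)
      (.cons .empty hab (by simp) (by simp)) ?_ (fun v hv => (mem_filter.1 hv).2) (by omega)
    rw [disjoint_insert_right, disjoint_insert_right]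
    exact ⟨hab'.1, hab'.2, disjoint_empty_right _⟩

/-- T_3 needs a cherry centred at a neighbour of `u`. A large neighbour supplies one, and the T_2
argument applies; otherwise a fixed cherry must be avoided, whence the weaker bounds k+1 for
matchings and k for large vertices. -/
theorem exists_universal_or_treeT3_of_large_degree {k : ℕ} (hk : 3 ≤ k)
    (hV : 100 * (k + 10) ^ 2 ≤ Fintype.card V) {u : V}
    (hu : k * Fintype.card V + k * G.degree u
      ≤ ∑ v ∈ G.neighborFinset u, G.degree v + k * k + G.degree u)
    (hd : 2 * k + 2 ≤ G.degree u) :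
    (∃ K : Finset V, K.card = k ∧ ∀ v ∈ K, ∀ w, w ≠ v → G.Adj v w) ∨ (treeT3 k).IsContained G := by
  by_contra hcon
  obtain ⟨hK, hT⟩ := not_or.1 hcon
  have key : ∀ s X C c, HasMatchingOn (nearGraph G u) s X → Disjoint C X →
      (∀ v ∈ C, 2 * k + 10 ≤ (nearGraph G u).degree v) → c ∈ C → G.Adj u c → s + C.card ≠ k := by
    intro s X C c hX hCX hC hc huc hcard
    obtain ⟨x, hx, hx'⟩ : ∃ x ∈ G.neighborFinset u, x ∉ X ∪ C := by
      apply exists_mem_notMem_of_card_lt_card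
      rw [G.card_neighborFinset_eq_degree]
      have := card_union_le X C
      have := hX.card_eq
      omega
    simp only [SimpleGraph.mem_neighborFinset, mem_union, not_or] at hx hx'
    exact hT (treeT3_isContained_of_large_degrees hX hCX hC hcard hc huc hx hx'.1 hx'.2)
  -- Otherwise the degree sum over the neighbours of `u` is at most 2d, and kn + kd ≤ 3d + k² fails.
  obtain ⟨c, huc, hc⟩ : ∃ c, G.Adj u c ∧ 2 ≤ (nearGraph G u).degree c := by
    by_contra! hc
    have h1 := sum_degree_nearGraph (G := G) u
    have h2 : ∑ v ∈ G.neighborFinset u, (nearGraph G u).degree v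
        ≤ (G.neighborFinset u).card * 1 := sum_le_card_nsmul _ _ _ fun v hv => by
      have := hc v ((SimpleGraph.mem_neighborFinset _ _ _).1 hv)
      omega
    rw [G.card_neighborFinset_eq_degree] at h2
    have h3 : 3 * G.degree u ≤ k * G.degree u := Nat.mul_le_mul_right _ hk
    nlinarith
  rw [← SimpleGraph.card_neighborFinset_eq_degree] at hc
  obtain ⟨a, b, ha, hb, hab⟩ := one_lt_card_iff.1 hc
  rw [SimpleGraph.mem_neighborFinset] at ha hb
  have hab3 : ({c, a, b} : Finset V).card ≤ 3 := card_le_three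
  have hab2 : ({a, b} : Finset V).card ≤ 2 := card_le_two
  obtain ⟨B, hB⟩ : ∃ B : Finset V, ∀ v, v ∈ B ↔ 2 * k + 10 ≤ (nearGraph G u).degree v :=
    ⟨univ.filter fun v => 2 * k + 10 ≤ (nearGraph G u).degree v, fun v => by simp⟩
  have hBN : ∀ c ∈ B, G.Adj u c → B.card + 1 ≤ k := by
    intro z hz huz
    by_contra! hlt
    obtain ⟨C, hzC, hC, hCk⟩ := exists_subsuperset_card_eq (singleton_subset_iff.2 hz)
      (show _ ≤ k by rw [card_singleton]; omega) (Nat.le_of_lt_succ hlt)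
    exact key 0 ∅ C z .empty (by simp) (fun v hv => (hB v).1 (hC hv))
      (singleton_subset_iff.1 hzC) huz (by omega)
  apply hK
  refine exists_universal_of_matching_bound hk hV hu ?_ hB ?_ hBN ?_
  · intro s X hX
    by_contra! hs
    -- Of k+2 edges the cherry spoils at most three, leaving k-1.
    obtain ⟨t, Y, -, hY, hYd, ht⟩ := hX.exists_disjoint {c, a, b}
    have := card_le_card (inter_subset_left (s₁ := {c, a, b}) (s₂ := X))
    obtain ⟨Z, hZY, hZ⟩ := hY.exists_subset (show k - 1 ≤ t by omega)
    exact hT (treeT3_isContained_of_cherry (by omega) hZ (disjoint_empty_left _) (by simp) (by simp)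
      huc ha hb hab (disjoint_of_subset_left hZY hYd) (by simp) hd)
  · by_contra! hlt
    -- So only `a` and `b` can lie in `B`, and k-1 of its k+1 or more vertices avoid the cherry.
    have hcB : c ∉ B := fun h => by
      have := hBN c h huc
      omega
    have h1 := le_card_sdiff {a, b} B
    obtain ⟨C, hC, hCk⟩ := exists_subset_card_eq (show k - 1 ≤ (B \ {a, b}).card by omega)
    refine hT (treeT3_isContained_of_cherry (by omega) .empty (disjoint_empty_right C)
      (fun v hv => (hB v).1 (mem_sdiff.1 (hC hv)).1) (by omega) huc ha hb hab (by simp) ?_ hd)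
    rw [disjoint_insert_right]
    exact ⟨fun h => hcB (mem_sdiff.1 (hC h)).1, disjoint_of_subset_left hC sdiff_disjoint⟩
  · intro z hz huz hcard a b hab
    by_contra! hab'
    refine key (0 + 1) _ _ z (.cons .empty hab (by simp) (by simp)) ?_ (fun v hv => (hB v).1 hv)
      hz huz (by omega)
    rw [disjoint_insert_right, disjoint_insert_right]
    exact ⟨hab'.1, hab'.2, disjoint_empty_right _⟩

end Counting

/-! ### The case where `u` has degree at most 2k+1. -/

section SmallDegree

open Classical Finset

variable {V : Type*} [Fintype V] {G : SimpleGraph V}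

/-- With fewer than k neighbours of large degree, the degree sum would be at most (k-1)n + O(k²). -/
theorem exists_large_neighbors_of_small_degree {k : ℕ} (hV : 100 * (k + 10) ^ 2 ≤ Fintype.card V)
    {u : V} (hu : k * Fintype.card V + k * G.degree u
      ≤ ∑ v ∈ G.neighborFinset u, G.degree v + k * k + G.degree u)
    (hd : G.degree u ≤ 2 * k + 1) :
    ∃ B ⊆ G.neighborFinset u, B.card = k ∧
      ∀ v ∈ B, 2 * k + 10 ≤ (nearGraph G u).degree v := by
  set N := G.neighborFinset u with hN
  let L := N.filter fun v => 2 * k + 11 ≤ G.degree v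
  have hNc : N.card = G.degree u := G.card_neighborFinset_eq_degree u
  have hL : k ≤ L.card := by
    by_contra! hlt
    have h1 : ∑ v ∈ L, G.degree v ≤ L.card * Fintype.card V :=
      sum_le_card_nsmul _ _ _ fun v _ => (G.degree_lt_card_verts v).le
    have h2 : ∑ v ∈ N with ¬ 2 * k + 11 ≤ G.degree v, G.degree v ≤ (2 * k + 1) * (2 * k + 11) := by
      refine (sum_le_card_nsmul _ _ (2 * k + 11) fun v hv => ?_).trans ?_
      · have := (mem_filter.1 hv).2
        omega
      · rw [smul_eq_mul]
        gcongr
        exact (card_le_card (filter_subset _ _)).trans (by omega)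
    have h3 := sum_filter_add_sum_filter_not N (fun v => 2 * k + 11 ≤ G.degree v)
      (fun v => G.degree v)
    have h4 : (L.card + 1) * Fintype.card V ≤ k * Fintype.card V := Nat.mul_le_mul_right _ hlt
    change ∑ v ∈ L, G.degree v + _ = _ at h3
    nlinarith
  obtain ⟨B, hBL, hB⟩ := exists_subset_card_eq hL
  refine ⟨B, hBL.trans (filter_subset _ _), hB, fun v hv => ?_⟩
  obtain ⟨h1, h2⟩ := mem_filter.1 (hBL hv)
  have := degree_nearGraph_add_one ((SimpleGraph.mem_neighborFinset _ _ _).1 h1)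
  omega

/-- For d(u) = k the inequality says that the k neighbours have degree sum at least k(n-1), the
maximum possible. -/
theorem exists_universal_of_degree_eq {k : ℕ} {u : V}
    (hu : k * Fintype.card V + k * G.degree u
      ≤ ∑ v ∈ G.neighborFinset u, G.degree v + k * k + G.degree u)
    (hd : G.degree u = k) :
    ∃ K : Finset V, K.card = k ∧ ∀ v ∈ K, ∀ w, w ≠ v → G.Adj v w := by
  have hNc := G.card_neighborFinset_eq_degree u
  refine ⟨G.neighborFinset u, by omega, fun v hv w hw => ?_⟩
  have hle : ∀ v ∈ G.neighborFinset u, G.degree v + 1 ≤ Fintype.card V :=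
    fun v _ => G.degree_lt_card_verts v
  refine adj_of_degree_add_one_eq ((sum_eq_sum_iff_of_le hle).1 ?_ v hv) w hw
  refine le_antisymm (sum_le_sum hle) ?_
  rw [sum_add_distrib, sum_const, sum_const, hNc, hd, smul_eq_mul, smul_eq_mul]
  rw [hd] at hu
  linarith

theorem exists_universal_or_treeT3_of_small_degree {k : ℕ} (hk : 3 ≤ k)
    (hV : 100 * (k + 10) ^ 2 ≤ Fintype.card V) {u : V}
    (hu : k * Fintype.card V + k * G.degree u
      ≤ ∑ v ∈ G.neighborFinset u, G.degree v + k * k + G.degree u)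
    (hd : G.degree u ≤ 2 * k + 1) :
    (∃ K : Finset V, K.card = k ∧ ∀ v ∈ K, ∀ w, w ≠ v → G.Adj v w) ∨ (treeT3 k).IsContained G := by
  obtain ⟨B, hBN, hB, hdeg⟩ := exists_large_neighbors_of_small_degree hV hu hd
  have hle := card_le_card hBN
  rw [G.card_neighborFinset_eq_degree] at hle
  by_cases hdk : G.degree u = k
  · exact Or.inl (exists_universal_of_degree_eq hu hdk)
  right
  obtain ⟨x, hx, hxB⟩ : ∃ x ∈ G.neighborFinset u, x ∉ B := by
    apply exists_mem_notMem_of_card_lt_card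
    rw [G.card_neighborFinset_eq_degree]
    omega
  obtain ⟨c, hc⟩ := card_pos.1 (show 0 < B.card by omega)
  exact treeT3_isContained_of_large_degrees .empty (disjoint_empty_right _) hdeg (by omega) hc
    ((SimpleGraph.mem_neighborFinset _ _ _).1 (hBN hc))
    ((SimpleGraph.mem_neighborFinset _ _ _).1 hx) (by simp) hxB

/-- When `u` has exactly `k + 1` neighbours, one of them is the root of a copy of `T_2`. -/
theorem treeT2_isContained_of_degree_eq {k : ℕ} (hk : 3 ≤ k)
    (hV : 100 * (k + 10) ^ 2 ≤ Fintype.card V) {u : V}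
    (hu : k * Fintype.card V + k * G.degree u
      ≤ ∑ v ∈ G.neighborFinset u, G.degree v + k * k + G.degree u)
    (hd : G.degree u = k + 1) : (treeT2 k).IsContained G := by
  have hNc := G.card_neighborFinset_eq_degree u
  have hadj : ∀ v ∈ G.neighborFinset u, G.Adj u v :=
    fun v hv => (SimpleGraph.mem_neighborFinset _ _ _).1 hv
  set N := G.neighborFinset u
  rw [hd] at hNc hu
  have hS : k * Fintype.card V ≤ ∑ v ∈ N, G.degree v + 1 := by linarith
  -- The root is a neighbour `r` of maximum degree. The edge from `u` to the neighbour `t` of least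
  -- remaining degree gives one matching edge, and the other k-1 neighbours of `u` will be large for
  -- `r`.
  obtain ⟨r, hr, hrmax⟩ := N.exists_max_image (fun v => G.degree v) (card_pos.1 (by omega))
  have hNr := card_erase_add_one hr
  obtain ⟨t, ht, htmin⟩ := (N.erase r).exists_min_image (fun v => G.degree v)
    (card_pos.1 (by omega))
  have hNt := card_erase_add_one ht
  have hur := hadj r hr
  have hut := hadj t (mem_of_mem_erase ht)
  have hrt : t ≠ r := (mem_erase.1 ht).1
  set B := (N.erase r).erase t with hB
  have hcodeg : ∀ v ∈ B, 2 * k + 10 ≤ (nearGraph G r).degree v := by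
    intro v hv
    have hv' := mem_of_mem_erase hv
    have hvN := mem_of_mem_erase hv'
    have hvr : v ≠ r := (mem_erase.1 hv').1
    have hBv := card_erase_add_one hv
    have h1 : ∑ w ∈ B.erase v, (G.degree w + 1) ≤ (B.erase v).card * Fintype.card V :=
      sum_le_card_nsmul _ _ _ fun w _ => G.degree_lt_card_verts w
    rw [sum_add_distrib, sum_const, smul_eq_mul, mul_one] at h1
    have h2 := add_sum_erase N (fun v => G.degree v) hr
    have h3 := add_sum_erase (N.erase r) (fun v => G.degree v) ht
    have h4 := add_sum_erase B (fun v => G.degree v) hv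
    rw [← hB] at h3
    have h5 : ∑ v ∈ N, G.degree v ≤ N.card * G.degree r := sum_le_card_nsmul _ _ _ hrmax
    have h6 := htmin v hv'
    have h7 := G.degree_lt_card_verts r
    have h8 : G.degree r + G.degree v
        ≤ Fintype.card V + (G.neighborFinset r ∩ G.neighborFinset v).card := by
      rw [← G.card_neighborFinset_eq_degree r, ← G.card_neighborFinset_eq_degree v,
        ← card_union_add_card_inter]
      gcongr
      exact card_le_univ _
    have h9 : (G.neighborFinset r ∩ G.neighborFinset v).card ≤ (nearGraph G r).degree v := by
      rw [← SimpleGraph.card_neighborFinset_eq_degree]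
      refine card_le_card fun w hw => ?_
      rw [mem_inter, SimpleGraph.mem_neighborFinset, SimpleGraph.mem_neighborFinset] at hw
      rw [SimpleGraph.mem_neighborFinset]
      exact ⟨hw.2, hvr, hw.1.ne', Or.inr hw.1⟩
    obtain ⟨q, hq⟩ : ∃ q, k = q + 2 := ⟨k - 2, by omega⟩
    have h10 : (B.erase v).card = q := by omega
    rw [h10] at h1
    rw [hNc] at h5
    set n := Fintype.card V
    -- As d(t) ≤ d(v), the sum bound kn - 1 gives d(v) ≥ n/2, and averaging gives d(r) ≥ 3n/4 - 1.
    -- Hence `r` and `v` have at least n/4 - 1 common neighbours.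
    have h11 : n ≤ 2 * G.degree v := by
      subst hq
      nlinarith
    have h12 : 3 * n ≤ 4 * G.degree r + 4 := by
      by_contra! hlt
      have : (k + 1) * (4 * G.degree r + 4) ≤ (k + 1) * (3 * n) :=
        Nat.mul_le_mul_left _ hlt.le
      have : 3 * n ≤ k * n := Nat.mul_le_mul_right _ hk
      nlinarith
    nlinarith
  have hm : HasMatchingOn (nearGraph G r) (0 + 1) (insert u (insert t ∅)) :=
    .cons .empty ⟨hut, hur.ne, hrt, Or.inl hur.symm⟩ (by simp) (by simp)
  have huN : u ∉ N := fun h => (hadj u h).ne rfl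
  have hdis : Disjoint B (insert u (insert t ∅)) := by
    rw [disjoint_insert_right, disjoint_insert_right]
    exact ⟨fun h => huN (mem_of_mem_erase (mem_of_mem_erase h)), notMem_erase t _,
      disjoint_empty_right _⟩
  obtain ⟨x, y, hx, hy, hxy⟩ : ∃ x y, x ∈ G.neighborFinset r \ (insert u (insert t ∅) ∪ B) ∧
      y ∈ G.neighborFinset r \ (insert u (insert t ∅) ∪ B) ∧ x ≠ y := by
    apply one_lt_card_iff.1
    have h1 := le_card_sdiff (insert u (insert t ∅) ∪ B) (G.neighborFinset r)
    rw [G.card_neighborFinset_eq_degree] at h1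
    have h2 := card_union_le (insert u (insert t ∅)) B
    have h3 := hm.card_eq
    have h5 : ∑ v ∈ N, G.degree v ≤ N.card * G.degree r := sum_le_card_nsmul _ _ _ hrmax
    have h6 : k + 5 ≤ G.degree r := by
      by_contra! hlt
      rw [hNc] at h5
      have h7 : (k + 1) * G.degree r ≤ (k + 1) * (k + 5) := Nat.mul_le_mul_left _ hlt.le
      have h8 : 3 * Fintype.card V ≤ k * Fintype.card V := Nat.mul_le_mul_right _ hk
      nlinarith
    omega
  simp only [mem_sdiff, SimpleGraph.mem_neighborFinset, mem_union, not_or] at hx hy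
  exact treeT2_isContained_of_large_degrees hm hdis hcodeg (by omega) hx.1 hy.1 hxy hx.2.1 hy.2.1
    hx.2.2 hy.2.2

theorem exists_universal_or_treeT2_of_small_degree {k : ℕ} (hk : 3 ≤ k)
    (hV : 100 * (k + 10) ^ 2 ≤ Fintype.card V) {u : V}
    (hu : k * Fintype.card V + k * G.degree u
      ≤ ∑ v ∈ G.neighborFinset u, G.degree v + k * k + G.degree u)
    (hd : G.degree u ≤ 2 * k + 1) :
    (∃ K : Finset V, K.card = k ∧ ∀ v ∈ K, ∀ w, w ≠ v → G.Adj v w) ∨ (treeT2 k).IsContained G := by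
  obtain ⟨B, hBN, hB, hdeg⟩ := exists_large_neighbors_of_small_degree hV hu hd
  have hle := card_le_card hBN
  rw [G.card_neighborFinset_eq_degree] at hle
  by_cases hdk : G.degree u = k
  · exact Or.inl (exists_universal_of_degree_eq hu hdk)
  right
  by_cases hdk' : G.degree u = k + 1
  · exact treeT2_isContained_of_degree_eq hk hV hu hdk'
  obtain ⟨x, y, hx, hy, hxy⟩ : ∃ x y, x ∈ G.neighborFinset u \ B ∧
      y ∈ G.neighborFinset u \ B ∧ x ≠ y := by
    apply one_lt_card_iff.1
    rw [card_sdiff_of_subset hBN, G.card_neighborFinset_eq_degree]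
    omega
  rw [mem_sdiff, SimpleGraph.mem_neighborFinset] at hx hy
  exact treeT2_isContained_of_large_degrees .empty (disjoint_empty_right _) hdeg (by omega)
    hx.1 hy.1 hxy (by simp) (by simp) hx.2 hy.2

end SmallDegree

/-! ### From the spectral radius to a row-sum inequality. -/

section SpectralRadius

open Classical Finset Matrix

variable {V : Type*} [Fintype V] {G : SimpleGraph V}

theorem le_graphSpectralRadius {x : V → ℝ} {θ : ℝ} (hx : x ≠ 0)
    (h : G.adjMatrix ℝ *ᵥ x = θ • x) : θ ≤ graphSpectralRadius G := by
  obtain ⟨v, -⟩ := Function.ne_iff.1 hx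
  have : Nonempty V := ⟨v⟩
  refine (isGreatest_graphSpectralRadius G).2 ?_
  refine Module.End.hasEigenvalue_of_hasEigenvector (x := x) ⟨?_, hx⟩
  rw [Module.End.mem_eigenspace_iff, Matrix.toLin'_apply]
  exact h

theorem posSemidef_graphSpectralRadius_sub_adjMatrix [Nonempty V] (G : SimpleGraph V) :
    (algebraMap ℝ (Matrix V V ℝ) (graphSpectralRadius G) - G.adjMatrix ℝ).PosSemidef := by
  rw [Matrix.posSemidef_iff_isHermitian_and_spectrum_nonneg]
  constructor
  · rw [Matrix.IsHermitian, Matrix.conjTranspose_eq_transpose_of_trivial, Matrix.transpose_sub,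
      SimpleGraph.transpose_adjMatrix, Matrix.algebraMap_eq_diagonal, Matrix.diagonal_transpose]
  · rw [← spectrum.singleton_sub_eq]
    rintro _ ⟨a, rfl, b, hb, rfl⟩
    rw [← Matrix.spectrum_toLin', ← Module.End.hasEigenvalue_iff_mem_spectrum] at hb
    exact sub_nonneg.2 ((isGreatest_graphSpectralRadius G).2 hb)

/-- Taking absolute values of a top eigenvector does not decrease its Rayleigh quotient, so the
positive semidefinite form of ρ - A vanishes there and the vector lies in its kernel. Connectedness
plays no role. -/
theorem exists_nonneg_eigenvector [Nonempty V] (G : SimpleGraph V) :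
    ∃ x : V → ℝ, x ≠ 0 ∧ (∀ v, 0 ≤ x v) ∧ G.adjMatrix ℝ *ᵥ x = graphSpectralRadius G • x := by
  obtain ⟨y, hy, hy0⟩ := (isGreatest_graphSpectralRadius G).1.exists_hasEigenvector
  rw [Module.End.mem_eigenspace_iff, Matrix.toLin'_apply] at hy
  set ρ := graphSpectralRadius G
  have hM : ∀ z : V → ℝ, (algebraMap ℝ (Matrix V V ℝ) ρ - G.adjMatrix ℝ) *ᵥ z
      = ρ • z - G.adjMatrix ℝ *ᵥ z := by
    intro z
    rw [Matrix.sub_mulVec, Algebra.algebraMap_eq_smul_one, Matrix.smul_mulVec, Matrix.one_mulVec]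
  have hP := posSemidef_graphSpectralRadius_sub_adjMatrix G
  refine ⟨fun v => |y v|, ?_, fun v => abs_nonneg _, ?_⟩
  · intro h
    apply hy0
    funext v
    exact abs_eq_zero.1 (congrFun h v)
  · have h0 := hP.dotProduct_mulVec_nonneg (fun v => |y v|)
    have h1 : star (fun v => |y v|) ⬝ᵥ
        ((algebraMap ℝ (Matrix V V ℝ) ρ - G.adjMatrix ℝ) *ᵥ fun v => |y v|) = 0 := by
      refine le_antisymm ?_ h0
      have h2 : y ⬝ᵥ (ρ • y - G.adjMatrix ℝ *ᵥ y) = 0 := by rw [hy]; simp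
      rw [hM, star_trivial, ← h2, dotProduct_sub, dotProduct_sub, dotProduct_smul, dotProduct_smul,
        SimpleGraph.dotProduct_mulVec_adjMatrix, SimpleGraph.dotProduct_mulVec_adjMatrix]
      have h3 : (fun v => |y v|) ⬝ᵥ (fun v => |y v|) = y ⬝ᵥ y :=
        sum_congr rfl fun v _ => abs_mul_abs_self _
      rw [h3]
      refine sub_le_sub_left (sum_le_sum fun i _ => sum_le_sum fun j _ => ?_) _
      split_ifs
      · rw [← abs_mul]
        exact le_abs_self _
      · exact le_rfl
    rw [hP.dotProduct_mulVec_zero_iff, hM, sub_eq_zero] at h1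
    exact h1.symm

/-- If `x ↦ x ^ 2 - a x` exceeds `b` at the spectral radius of `G`, then some row sum of
`A ^ 2 - a A` is at least `b`, where `A` is the adjacency matrix. -/
theorem exists_le_sum_degree_neighbors [Nonempty V] (G : SimpleGraph V) {a b : ℝ}
    (h : b ≤ graphSpectralRadius G ^ 2 - a * graphSpectralRadius G) :
    ∃ u, b + a * G.degree u ≤ ∑ v ∈ G.neighborFinset u, (G.degree v : ℝ) := by
  obtain ⟨x, hx0, hx, hAx⟩ := exists_nonneg_eigenvector G
  set ρ := graphSpectralRadius G
  -- Symmetry of A moves it from `x` to `f`. Taking `f` constant 1 and then the degree function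
  -- evaluates the row sums of A and A² against `x`.
  have hsymm : ∀ f : V → ℝ, ρ * ∑ v, f v * x v = ∑ v, (∑ w ∈ G.neighborFinset v, f w) * x v := by
    intro f
    calc ρ * ∑ v, f v * x v = f ⬝ᵥ (G.adjMatrix ℝ *ᵥ x) := by
          rw [hAx, dotProduct_smul]
          rfl
      _ = (G.adjMatrix ℝ *ᵥ f) ⬝ᵥ x := by
          rw [dotProduct_mulVec, ← mulVec_transpose, SimpleGraph.transpose_adjMatrix]
      _ = _ := sum_congr rfl fun v _ => by rw [SimpleGraph.adjMatrix_mulVec_apply]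
  have h1 : ρ * ∑ v, x v = ∑ v, (G.degree v : ℝ) * x v := by
    have := hsymm fun _ => 1
    simpa using this
  have h2 := hsymm fun v => (G.degree v : ℝ)
  rw [← h1] at h2
  by_contra! hcon
  have hpos : 0 < ∑ v, x v := by
    obtain ⟨v, hv⟩ := Function.ne_iff.1 hx0
    exact sum_pos' (fun v _ => hx v) ⟨v, mem_univ v, lt_of_le_of_ne (hx v) (Ne.symm hv)⟩
  have h3 : ∑ v, (∑ w ∈ G.neighborFinset v, (G.degree w : ℝ)) * x v
      < ∑ v, (b + a * G.degree v) * x v := by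
    obtain ⟨v, hv⟩ := Function.ne_iff.1 hx0
    refine sum_lt_sum (fun v _ => mul_le_mul_of_nonneg_right (hcon v).le (hx v)) ⟨v, mem_univ v, ?_⟩
    exact mul_lt_mul_of_pos_right (hcon v) (lt_of_le_of_ne (hx v) (Ne.symm hv))
  have h4 : ∑ v, (b + a * G.degree v) * x v = b * ∑ v, x v + a * (ρ * ∑ v, x v) := by
    rw [h1, mul_sum, mul_sum, ← sum_add_distrib]
    exact sum_congr rfl fun v _ => by ring
  rw [← h2, h4] at h3
  nlinarith

/-- The vector equal to θ on the clique and k elsewhere is an eigenvector for θ. Only this lower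
bound is needed. -/
theorem le_graphSpectralRadius_splitGraph {n k : ℕ} (hk : 1 ≤ k) (hkn : k < n) {θ : ℝ}
    (hθ : θ ^ 2 = (k - 1) * θ + k * (n - k)) : θ ≤ graphSpectralRadius (splitGraph n k) := by
  have hc : ((univ.filter fun i : Fin n => i.val < k).card : ℝ) = k := by
    have h := Fin.card_filter_val_lt (n := n) (m := k)
    rw [min_eq_right hkn.le] at h
    exact_mod_cast h
  have hc' : ((univ.filter fun i : Fin n => ¬ i.val < k).card : ℝ) = n - k := by
    have h := card_filter_add_card_filter_not (s := (univ : Finset (Fin n))) (fun i => i.val < k)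
    rw [card_univ, Fintype.card_fin] at h
    rw [eq_sub_iff_add_eq', ← hc]
    exact_mod_cast h
  have hk0 : (k : ℝ) ≠ 0 := by positivity
  refine le_graphSpectralRadius (x := fun i : Fin n => if i.val < k then θ else (k : ℝ)) ?_ ?_
  · intro h
    have := congrFun h ⟨k, hkn⟩
    simp [hk0] at this
  · funext i
    rw [SimpleGraph.adjMatrix_mulVec_apply, Pi.smul_apply, smul_eq_mul]
    by_cases hi : i.val < k
    · have hN : (splitGraph n k).neighborFinset i = univ.erase i := by
        ext j
        rw [SimpleGraph.mem_neighborFinset, mem_erase]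
        change (i ≠ j ∧ _) ↔ _
        simp [hi, eq_comm]
      rw [hN, sum_erase_eq_sub (mem_univ i), sum_ite, sum_const, sum_const, nsmul_eq_mul,
        nsmul_eq_mul, hc, hc', if_pos hi]
      linarith
    · have hN : (splitGraph n k).neighborFinset i = univ.filter fun j : Fin n => j.val < k := by
        ext j
        rw [SimpleGraph.mem_neighborFinset, mem_filter]
        change (i ≠ j ∧ _) ↔ _
        simp only [hi, false_or, mem_univ, true_and, and_iff_right_iff_imp]
        rintro hj rfl
        exact hi hj
      rw [hN, sum_congr rfl fun j hj => if_pos (mem_filter.1 hj).2, sum_const, nsmul_eq_mul, hc,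
        if_neg hi, mul_comm]

theorem exists_row_sum_ge_of_splitGraph_le {n k : ℕ} (hk : 1 ≤ k) (hkn : k < n)
    {G : SimpleGraph (Fin n)}
    (h : graphSpectralRadius (splitGraph n k) ≤ graphSpectralRadius G) :
    ∃ u, k * Fintype.card (Fin n) + k * G.degree u
      ≤ ∑ v ∈ G.neighborFinset u, G.degree v + k * k + G.degree u := by
  have : Nonempty (Fin n) := ⟨⟨k, hkn⟩⟩
  have hk1 : (1 : ℝ) ≤ k := by exact_mod_cast hk
  have hkn' : (k : ℝ) < n := by exact_mod_cast hkn
  have hD : (0 : ℝ) ≤ (k - 1) ^ 2 + 4 * (k * (n - k)) := by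
    have := mul_nonneg (zero_le_one.trans hk1) (sub_nonneg.2 hkn'.le)
    positivity
  set r := √((k - 1 : ℝ) ^ 2 + 4 * (k * (n - k)))
  have hr : r ^ 2 = (k - 1 : ℝ) ^ 2 + 4 * (k * (n - k)) := Real.sq_sqrt hD
  have hr0 : 0 ≤ r := Real.sqrt_nonneg _
  have hθ := (le_graphSpectralRadius_splitGraph hk hkn (θ := (k - 1 + r) / 2) (by nlinarith)).trans h
  obtain ⟨u, hu⟩ := exists_le_sum_degree_neighbors G (a := k - 1) (b := k * (n - k)) (by
    -- This product is the increment of x² - (k-1)x from the root θ to the spectral radius of `G`.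
    have : 0 ≤ (graphSpectralRadius G - (k - 1 + r) / 2) *
      (graphSpectralRadius G + (k - 1 + r) / 2 - (k - 1)) :=
        mul_nonneg (by linarith) (by linarith)
    nlinarith)
  refine ⟨u, ?_⟩
  rw [Fintype.card_fin]
  have : (k * n + k * G.degree u : ℝ)
      ≤ ∑ v ∈ G.neighborFinset u, (G.degree v : ℝ) + k * k + G.degree u := by linarith
  exact_mod_cast this

end SpectralRadius

/-! ### The main theorem. -/

theorem theorem4p2 (k : ℕ) (hk : 3 ≤ k) :
    ∃ N : ℕ, ∀ n : ℕ, N ≤ n → ∀ G : SimpleGraph (Fin n),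
      graphSpectralRadius (splitGraph n k) ≤ graphSpectralRadius G →
      ¬ Nonempty (G ≃g splitGraph n k) →
      (treeT2 k).IsContained G ∧ (treeT3 k).IsContained G := by
  classical
  refine ⟨100 * (k + 10) ^ 2, fun n hn G hG hiso => ?_⟩
  have hkn : 3 * k + 20 ≤ n := by nlinarith
  obtain ⟨u, hu⟩ := exists_row_sum_ge_of_splitGraph_le (by omega) (by omega) hG
  rw [← Fintype.card_fin n] at hn
  have huniv : (∃ K : Finset (Fin n), K.card = k ∧ ∀ v ∈ K, ∀ w, w ≠ v → G.Adj v w) →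
      (treeT2 k).IsContained G ∧ (treeT3 k).IsContained G := by
    rintro ⟨K, hK, hKu⟩
    by_cases hind : ∀ x y, G.Adj x y → x ∈ K ∨ y ∈ K
    · exact absurd (nonempty_iso_splitGraph (by omega) hK hKu hind) hiso
    · push Not at hind
      obtain ⟨x, y, hxy, hx, hy⟩ := hind
      exact trees_isContained_of_universal (by omega) (by rwa [Fintype.card_fin]) hK hKu hxy hx hy
  rcases le_or_gt (G.degree u) (2 * k + 1) with hd | hd
  · rcases exists_universal_or_treeT2_of_small_degree hk hn hu hd with h2 | h2
    · exact huniv h2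
    rcases exists_universal_or_treeT3_of_small_degree hk hn hu hd with h3 | h3
    · exact huniv h3
    exact ⟨h2, h3⟩
  · rcases exists_universal_or_treeT2_of_large_degree hk hn hu hd with h2 | h2
    · exact huniv h2
    rcases exists_universal_or_treeT3_of_large_degree hk hn hu hd with h3 | h3
    · exact huniv h3
    exact ⟨h2, h3⟩
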